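/- Let $N\ge 1$ and let $\Omega\subset\mathbb{R}^N$ be a nonempty bounded open set (for example a bounded domain with smooth boundary). Put $2^*=\frac{2N}{N-2}$ if $N\ge 3$ and $2^*=+\infty$ if $N=1,2$, where $\frac{2^*}{2^*-1}$ is read as $1$ when $2^*=+\infty$. Let $a,b>0$ and let $f\in L^{\frac{2^*}{2^*-1}}(\Omega)$ satisfy $f>0$ a.e. in $\Omega$; if $N=2$, assume in addition that $fv\in L^1(\Omega)$ for every $v\in H_0^1(\Omega)$ (which holds for instance if $f\in L^q(\Omega)$ for some $q>1$). Here $H_0^1(\Omega)$ is the closure of $C_c^\infty(\Omega)$ in $H^1(\Omega)$, and $\|u\|=\big(\int_\Omega|\nabla u|^2\,dx\big)^{1/2}$. Then for every $\mu>0$ the problem $$-\Big(a-b\int_\Omega|\nabla u|^2\,dx\Big)\Delta u=\mu f(x)\ \text{ in }\Omega,\qquad u=0\ \text{ on }\partial\Omega,$$ has at least one weak solution $u\in H_0^1(\Omega)$ with $u<0$ a.e. in $\Omega$. That is, for every $v\in H_0^1(\Omega)$ the function $fv$ is integrable on $\Omega$ and $$\big(a-b\|u\|^2\big)\int_\Omega\nabla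 u\cdot\nabla v\,dx=\mu\int_\Omega fv\,dx .$$ Moreover, $u$ can be chosen such that $\|u\|^2>\frac ab$ and $$I(u)=\frac a2\|u\|^2-\frac b4\|u\|^4-\mu\int_\Omega fu\,dx>\frac{a^2}{4b}.$$ -/

import Mathlib

open MeasureTheory Filter Topology
open scoped ENNReal ContDiff

noncomputable section

/-- The critical Sobolev exponent `2^*` in dimension `N`: it is `2N/(N-2)` for `N ≥ 3`
and `∞` for `N = 1, 2`. -/
def criticalExponent (N : ℕ) : ℝ≥0∞ :=
  if 3 ≤ N then ENNReal.ofReal (2 * (N : ℝ) / ((N : ℝ) - 2)) else ⊤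

/-- The exponent `2^*/(2^* - 1) = 1 + 1/(2^* - 1)`, which is read as `1` when `2^* = ∞`. -/
def dualCriticalExponent (N : ℕ) : ℝ≥0∞ :=
  1 + (criticalExponent N - 1)⁻¹

/-- `φ ∈ C_c^∞(Ω)`. -/
def IsTestFunction {N : ℕ} (Ω : Set (EuclideanSpace ℝ (Fin N)))
    (φ : EuclideanSpace ℝ (Fin N) → ℝ) : Prop :=
  ContDiff ℝ ∞ φ ∧ HasCompactSupport φ ∧ tsupport φ ⊆ Ω

/-- `G` is a weak (distributional) gradient of `u` on `Ω`. -/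
def HasWeakGradient {N : ℕ} (Ω : Set (EuclideanSpace ℝ (Fin N)))
    (u : EuclideanSpace ℝ (Fin N) → ℝ)
    (G : EuclideanSpace ℝ (Fin N) → EuclideanSpace ℝ (Fin N)) : Prop :=
  LocallyIntegrableOn u Ω ∧ LocallyIntegrableOn G Ω ∧
    ∀ φ : EuclideanSpace ℝ (Fin N) → ℝ, IsTestFunction Ω φ →
      ∫ x in Ω, u x • gradient φ x = - ∫ x in Ω, φ x • G x

open Classical in
/-- The weak gradient `∇u` of `u` on `Ω` (unique almost everywhere in `Ω` when it exists, for open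
`Ω`; the value is `0` when there is none). -/
def weakGradient {N : ℕ} (Ω : Set (EuclideanSpace ℝ (Fin N)))
    (u : EuclideanSpace ℝ (Fin N) → ℝ) :
    EuclideanSpace ℝ (Fin N) → EuclideanSpace ℝ (Fin N) :=
  if h : ∃ G, HasWeakGradient Ω u G then h.choose else 0

/-- `u ∈ H^1(Ω)`: `u` and its weak gradient are square integrable on `Ω`. -/
def MemH1 {N : ℕ} (Ω : Set (EuclideanSpace ℝ (Fin N)))
    (u : EuclideanSpace ℝ (Fin N) → ℝ) : Prop :=
  MemLp u 2 (volume.restrict Ω) ∧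
    ∃ G, HasWeakGradient Ω u G ∧ MemLp G 2 (volume.restrict Ω)

/-- `u ∈ H_0^1(Ω)`: `u ∈ H^1(Ω)` is a limit of test functions in the norm of `H^1(Ω)`. -/
def MemH10 {N : ℕ} (Ω : Set (EuclideanSpace ℝ (Fin N)))
    (u : EuclideanSpace ℝ (Fin N) → ℝ) : Prop :=
  MemH1 Ω u ∧ ∃ φ : ℕ → EuclideanSpace ℝ (Fin N) → ℝ, (∀ n, IsTestFunction Ω (φ n)) ∧
    Tendsto (fun n => eLpNorm (fun x => φ n x - u x) 2 (volume.restrict Ω)) atTop (𝓝 0) ∧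
    Tendsto (fun n => eLpNorm (fun x => gradient (φ n) x - weakGradient Ω u x) 2
      (volume.restrict Ω)) atTop (𝓝 0)

/-- The inner product `⟨u, v⟩ = ∫_Ω ∇u · ∇v dx` of `H_0^1(Ω)`. -/
def h10Inner {N : ℕ} (Ω : Set (EuclideanSpace ℝ (Fin N)))
    (u v : EuclideanSpace ℝ (Fin N) → ℝ) : ℝ :=
  ∫ x in Ω, inner ℝ (weakGradient Ω u x) (weakGradient Ω v x)

/-- The norm `‖u‖ = (∫_Ω |∇u|² dx)^{1/2}` of `H_0^1(Ω)`. -/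
def h10Norm {N : ℕ} (Ω : Set (EuclideanSpace ℝ (Fin N)))
    (u : EuclideanSpace ℝ (Fin N) → ℝ) : ℝ :=
  Real.sqrt (∫ x in Ω, ‖weakGradient Ω u x‖ ^ 2)

/-- `u` is a weak solution of `-(a - b ∫_Ω |∇u|² dx) Δu = μ f` in `Ω`, `u = 0` on `∂Ω`.
All the integrals are required to make sense. -/
def IsWeakSolution {N : ℕ} (Ω : Set (EuclideanSpace ℝ (Fin N))) (a b μ : ℝ)
    (f u : EuclideanSpace ℝ (Fin N) → ℝ) : Prop :=
  MemH10 Ω u ∧ ∀ v : EuclideanSpace ℝ (Fin N) → ℝ, MemH10 Ω v →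
    IntegrableOn (fun x => f x * v x) Ω ∧
    (a - b * h10Norm Ω u ^ 2) * h10Inner Ω u v = μ * ∫ x in Ω, f x * v x

/-- The energy `I(u) = (a/2) ‖u‖² - (b/4) ‖u‖⁴ - μ ∫_Ω f u dx`. -/
def energy {N : ℕ} (Ω : Set (EuclideanSpace ℝ (Fin N))) (a b μ : ℝ)
    (f u : EuclideanSpace ℝ (Fin N) → ℝ) : ℝ :=
  a / 2 * h10Norm Ω u ^ 2 - b / 4 * h10Norm Ω u ^ 4 - μ * ∫ x in Ω, f x * u x

end

/-!
If `w ∈ H_0^1(Ω)` solves the linear problem `-Δw = f`, then `u = -s w` solves the nonlocal one as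
soon as `s (b s² ‖w‖² - a) = μ`, and this cubic equation has a root `s > 0`
(`exists_pos_cubic_eq`). At such a root `‖u‖² = s² ‖w‖² > a / b`, and testing the equation with `u`
gives `I(u) = (3b/4) ‖u‖⁴ - (a/2) ‖u‖²`, which exceeds `a² / (4b)` precisely because `‖u‖² > a / b`.
What remains is to solve the linear problem and to show `w > 0`.

The linear problem (`exists_dirichlet`) is the Lax-Milgram theorem in `H_0^1(Ω)`, realized as the
closure `h10Space` of the pairs `(φ, ∇φ)` in `L² × L²`; coercivity is the Poincaré inequality. The
right-hand side `v ↦ ∫ f v` is bounded by the closed graph theorem (`exists_clm_integral_mul`), so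
that only integrability of `f v` is needed. This is the Sobolev embedding when `N ≠ 2` and the
extra hypothesis when `N = 2`.

Positivity is obtained by inserting nonlinear functions of `w` into the weak equation. They are
approximated by the same functions of test functions `φ_n → w` (`integral_mul_comp_eq`), so no
chain rule in Sobolev spaces is required. A function `g` that is nondecreasing, negative on
`(-∞, 0)` and zero on `[0, ∞)` yields `w ≥ 0` (`ae_nonneg_of_dirichlet`). The functions
`η² exp(-k arctan w)` yield `∫_{w = 0} f η² ≤ k⁻¹ ∫ (1 + w²) |∇η|²` for every `k`, hence `w ≠ 0`
almost everywhere since `f > 0` (`ae_ne_zero_of_test_ne_zero`). Neither connectedness nor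
smoothness of `Ω` plays a role.
-/

/-! ### Test functions -/

section TestFunction

variable {N : ℕ} {Ω : Set (EuclideanSpace ℝ (Fin N))} {φ ψ : EuclideanSpace ℝ (Fin N) → ℝ}

lemma norm_gradient_eq_norm_fderiv (φ : EuclideanSpace ℝ (Fin N) → ℝ)
    (x : EuclideanSpace ℝ (Fin N)) : ‖gradient φ x‖ = ‖fderiv ℝ φ x‖ := by
  simp [gradient]

lemma inner_gradient_eq_fderiv (φ : EuclideanSpace ℝ (Fin N) → ℝ)
    (x v : EuclideanSpace ℝ (Fin N)) : inner ℝ (gradient φ x) v = fderiv ℝ φ x v := by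
  simp [gradient]

lemma continuous_gradient (h : ContDiff ℝ ∞ φ) : Continuous (gradient φ) :=
  (InnerProductSpace.toDual ℝ _).symm.continuous.comp (h.continuous_fderiv (by simp))

namespace IsTestFunction

lemma differentiable (h : IsTestFunction Ω φ) : Differentiable ℝ φ :=
  h.1.differentiable (by simp)

lemma eq_zero_of_notMem (h : IsTestFunction Ω φ) {x : EuclideanSpace ℝ (Fin N)} (hx : x ∉ Ω) :
    φ x = 0 :=
  image_eq_zero_of_notMem_tsupport fun h' => hx (h.2.2 h')

lemma fderiv_eq_zero_of_notMem (h : IsTestFunction Ω φ) {x : EuclideanSpace ℝ (Fin N)}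
    (hx : x ∉ Ω) : fderiv ℝ φ x = 0 := by
  by_contra hne
  exact hx (h.2.2 (support_fderiv_subset ℝ hne))

lemma gradient_eq_zero_of_notMem (h : IsTestFunction Ω φ) {x : EuclideanSpace ℝ (Fin N)}
    (hx : x ∉ Ω) : gradient φ x = 0 := by
  simp [gradient, h.fderiv_eq_zero_of_notMem hx]

lemma hasCompactSupport_gradient (h : IsTestFunction Ω φ) : HasCompactSupport (gradient φ) :=
  (h.2.1.fderiv ℝ).comp_left (g := (InnerProductSpace.toDual ℝ _).symm) (by simp)

lemma memLp (h : IsTestFunction Ω φ) (p : ℝ≥0∞) (μ : Measure (EuclideanSpace ℝ (Fin N)))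
    [IsFiniteMeasureOnCompacts μ] : MemLp φ p μ :=
  h.1.continuous.memLp_of_hasCompactSupport h.2.1

lemma memLp_gradient (h : IsTestFunction Ω φ) (p : ℝ≥0∞)
    (μ : Measure (EuclideanSpace ℝ (Fin N))) [IsFiniteMeasureOnCompacts μ] :
    MemLp (gradient φ) p μ :=
  (continuous_gradient h.1).memLp_of_hasCompactSupport h.hasCompactSupport_gradient

lemma zero : IsTestFunction Ω (0 : EuclideanSpace ℝ (Fin N) → ℝ) :=
  ⟨contDiff_const, HasCompactSupport.zero, by simp⟩

lemma add (h : IsTestFunction Ω φ) (h' : IsTestFunction Ω ψ) : IsTestFunction Ω (φ + ψ) :=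
  ⟨h.1.add h'.1, h.2.1.add h'.2.1, (tsupport_add φ ψ).trans (Set.union_subset h.2.2 h'.2.2)⟩

/-- A smooth multiple of a test function is a test function. -/
lemma mul_left (h : IsTestFunction Ω φ) {ζ : EuclideanSpace ℝ (Fin N) → ℝ}
    (hζ : ContDiff ℝ ∞ ζ) : IsTestFunction Ω (fun x => ζ x * φ x) :=
  ⟨hζ.mul h.1, h.2.1.mul_left, tsupport_mul_subset_right.trans h.2.2⟩

lemma const_smul (h : IsTestFunction Ω φ) (c : ℝ) : IsTestFunction Ω (c • φ) :=
  h.mul_left (ζ := fun _ => c) contDiff_const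

/-- A smooth function vanishing at `0`, composed with a test function, is a test function. -/
lemma comp_left (h : IsTestFunction Ω φ) {g : ℝ → ℝ} (hg : ContDiff ℝ ∞ g) (h0 : g 0 = 0) :
    IsTestFunction Ω (fun x => g (φ x)) :=
  ⟨hg.comp h.1, h.2.1.comp_left h0,
    (closure_mono (Function.support_comp_subset h0 φ)).trans h.2.2⟩

lemma gradient_add (h : IsTestFunction Ω φ) (h' : IsTestFunction Ω ψ) :
    gradient (φ + ψ) = gradient φ + gradient ψ := by
  ext1 x
  simp [gradient, fderiv_add (h.differentiable x) (h'.differentiable x)]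

lemma gradient_const_smul (h : IsTestFunction Ω φ) (c : ℝ) :
    gradient (c • φ) = c • gradient φ := by
  ext1 x
  simp [gradient, fderiv_const_smul (h.differentiable x)]

end IsTestFunction

lemma gradient_mul_comp {ζ : EuclideanSpace ℝ (Fin N) → ℝ} {g : ℝ → ℝ}
    {x : EuclideanSpace ℝ (Fin N)} (hζ : DifferentiableAt ℝ ζ x)
    (hg : DifferentiableAt ℝ g (φ x)) (hφ : DifferentiableAt ℝ φ x) :
    gradient (fun y => ζ y * g (φ y)) x
      = (ζ x * deriv g (φ x)) • gradient φ x + g (φ x) • gradient ζ x := by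
  have h1 : HasFDerivAt (fun y => g (φ y)) (deriv g (φ x) • fderiv ℝ φ x) x :=
    hg.hasDerivAt.comp_hasFDerivAt x hφ.hasFDerivAt
  have h2 : fderiv ℝ (fun y => ζ y * g (φ y)) x
      = ζ x • deriv g (φ x) • fderiv ℝ φ x + g (φ x) • fderiv ℝ ζ x :=
    (hζ.hasFDerivAt.mul h1).fderiv
  simp only [gradient, h2]
  simp [smul_smul]

/-- Integration by parts for a smooth function against a test function. -/
lemma IsTestFunction.setIntegral_mul_fderiv (hφ : IsTestFunction Ω φ)
    (hψ : ContDiff ℝ ∞ ψ) (v : EuclideanSpace ℝ (Fin N)) :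
    ∫ x in Ω, ψ x * fderiv ℝ φ x v = -∫ x in Ω, fderiv ℝ ψ x v * φ x := by
  rw [setIntegral_eq_integral_of_forall_compl_eq_zero fun x hx => by
      simp [hφ.fderiv_eq_zero_of_notMem hx],
    setIntegral_eq_integral_of_forall_compl_eq_zero fun x hx => by
      simp [hφ.eq_zero_of_notMem hx]]
  have hψ' : Continuous (fun x => fderiv ℝ ψ x v) :=
    (hψ.continuous_fderiv (by simp)).clm_apply continuous_const
  have hφ' : Continuous (fun x => fderiv ℝ φ x v) :=
    (hφ.1.continuous_fderiv (by simp)).clm_apply continuous_const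
  have hc : HasCompactSupport (fun x => fderiv ℝ φ x v) :=
    (hφ.2.1.fderiv ℝ).comp_left (g := fun L : _ →L[ℝ] ℝ => L v) (by simp)
  refine integral_mul_fderiv_eq_neg_fderiv_mul_of_integrable ?_ ?_ ?_
    (fun x _ => hψ.differentiable (by simp) x) (fun x _ => hφ.differentiable x)
  · exact (hψ'.mul hφ.1.continuous).integrable_of_hasCompactSupport hφ.2.1.mul_left
  · exact (hψ.continuous.mul hφ').integrable_of_hasCompactSupport hc.mul_left
  · exact (hψ.continuous.mul hφ.1.continuous).integrable_of_hasCompactSupport hφ.2.1.mul_left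

/-- The **Poincaré inequality** for test functions of a bounded set. It comes from integrating
`φ ^ 2 + 2 x₁ φ ∂₁φ = ∂₁(x₁ φ ^ 2)`. -/
lemma exists_poincare (hN : 1 ≤ N) (hΩ : Bornology.IsBounded Ω) :
    ∃ C : ℝ, 0 ≤ C ∧ ∀ φ : EuclideanSpace ℝ (Fin N) → ℝ, IsTestFunction Ω φ →
      ∫ x in Ω, φ x ^ 2 ≤ C * ∫ x in Ω, ‖gradient φ x‖ ^ 2 := by
  obtain ⟨R, hR⟩ := hΩ.exists_norm_le
  refine ⟨4 * R ^ 2, by positivity, fun φ hφ => ?_⟩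
  let i : Fin N := ⟨0, hN⟩
  let e : EuclideanSpace ℝ (Fin N) := EuclideanSpace.single i 1
  have hφ2 : IsTestFunction Ω (fun x => φ x * φ x) := hφ.mul_left hφ.1
  let L : EuclideanSpace ℝ (Fin N) →L[ℝ] ℝ := EuclideanSpace.proj i
  have hcoord : ∀ x, fderiv ℝ (fun y : EuclideanSpace ℝ (Fin N) => y i) x e = 1 := by
    intro x
    have h : fderiv ℝ (fun y : EuclideanSpace ℝ (Fin N) => y i) x = L := L.hasFDerivAt.fderiv
    rw [h]
    simp [L, e]
  have hparts := hφ2.setIntegral_mul_fderiv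
    (ψ := fun y : EuclideanSpace ℝ (Fin N) => y i)
    L.contDiff e
  have hd : ∀ x, fderiv ℝ (fun y => φ y * φ y) x e = 2 * φ x * fderiv ℝ φ x e := by
    intro x
    have h := (hφ.differentiable x).hasFDerivAt
    have h' : fderiv ℝ (fun y => φ y * φ y) x = φ x • fderiv ℝ φ x + φ x • fderiv ℝ φ x :=
      (h.mul h).fderiv
    rw [h']
    simp
    ring
  have hint1 : Integrable (fun x => φ x ^ 2) (volume.restrict Ω) :=
    (hφ.memLp 2 _).integrable_sq
  have hint2 : Integrable (fun x => ‖gradient φ x‖ ^ 2) (volume.restrict Ω) :=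
    (hφ.memLp_gradient 2 _).integrable_norm_pow (by simp)
  have hint3 : Integrable (fun x : EuclideanSpace ℝ (Fin N) =>
      -(x i * (2 * φ x * fderiv ℝ φ x e))) (volume.restrict Ω) := by
    refine (Continuous.integrable_of_hasCompactSupport ?_ ?_).restrict
    · have h1 : Continuous (fun x => fderiv ℝ φ x e) :=
        (hφ.1.continuous_fderiv (by simp)).clm_apply continuous_const
      have h2 := hφ.1.continuous
      fun_prop
    · exact (hφ.2.1.mul_left.mul_right.mul_left).neg
  have hkey : ∫ x in Ω, φ x ^ 2
      ≤ ∫ x in Ω, (1 / 2 * φ x ^ 2 + 2 * R ^ 2 * ‖gradient φ x‖ ^ 2) := by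
    have : ∫ x in Ω, φ x ^ 2 = ∫ x in Ω, -(x i * (2 * φ x * fderiv ℝ φ x e)) := by
      rw [integral_neg]
      simp only [hd, hcoord, one_mul] at hparts
      rw [hparts, neg_neg]
      simp only [pow_two]
    rw [this]
    refine integral_mono hint3 ((hint1.const_mul _).add (hint2.const_mul _)) fun x => ?_
    by_cases hx : x ∈ Ω
    · have h1 : |x i| ≤ R := by
        have := (PiLp.norm_apply_le x i).trans (hR x hx)
        simpa using this
      have h2 : |fderiv ℝ φ x e| ≤ ‖gradient φ x‖ := by
        rw [norm_gradient_eq_norm_fderiv]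
        have := (fderiv ℝ φ x).le_opNorm e
        simpa [e] using this
      have h3 : |x i * fderiv ℝ φ x e| ≤ R * ‖gradient φ x‖ := by
        rw [abs_mul]
        exact mul_le_mul h1 h2 (abs_nonneg _) ((abs_nonneg _).trans h1)
      have h4 : (x i * fderiv ℝ φ x e) ^ 2 ≤ (R * ‖gradient φ x‖) ^ 2 := sq_le_sq' (abs_le.1 h3).1
        (abs_le.1 h3).2
      change -(x i * (2 * φ x * fderiv ℝ φ x e))
        ≤ 1 / 2 * φ x ^ 2 + 2 * R ^ 2 * ‖gradient φ x‖ ^ 2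
      nlinarith [sq_nonneg (φ x + 2 * (x i * fderiv ℝ φ x e))]
    · change -(x i * (2 * φ x * fderiv ℝ φ x e))
        ≤ 1 / 2 * φ x ^ 2 + 2 * R ^ 2 * ‖gradient φ x‖ ^ 2
      rw [hφ.eq_zero_of_notMem hx]
      simp only [mul_zero, zero_mul, neg_zero]
      positivity
  rw [integral_add (hint1.const_mul _) (hint2.const_mul _), integral_const_mul,
    integral_const_mul] at hkey
  linarith

end TestFunction

/-! ### The Sobolev embedding for test functions -/

section Sobolev

variable {N : ℕ} {Ω : Set (EuclideanSpace ℝ (Fin N))}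

lemma one_le_criticalExponent (N : ℕ) : 1 ≤ criticalExponent N := by
  unfold criticalExponent
  split_ifs with h
  · have hN : (3 : ℝ) ≤ N := by exact_mod_cast h
    rw [← ENNReal.ofReal_one]
    refine ENNReal.ofReal_le_ofReal ?_
    rw [le_div_iff₀ (by linarith)]
    linarith
  · exact le_top

lemma holderConjugate_criticalExponent (N : ℕ) :
    (criticalExponent N).HolderConjugate (dualCriticalExponent N) :=
  .conjExponent (one_le_criticalExponent N)

lemma IsTestFunction.eLpNorm_gradient_restrict {φ : EuclideanSpace ℝ (Fin N) → ℝ}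
    (hφ : IsTestFunction Ω φ) (p : ℝ≥0∞) :
    eLpNorm (gradient φ) p (volume.restrict Ω) = eLpNorm (fderiv ℝ φ) p volume := by
  rw [eLpNorm_restrict_eq_of_support_subset]
  · exact eLpNorm_congr_norm_ae (.of_forall fun x => norm_gradient_eq_norm_fderiv φ x)
  · intro x hx
    by_contra h
    exact hx (hφ.gradient_eq_zero_of_notMem h)

/-- In dimension one a test function is bounded by the integral of its derivative. -/
lemma IsTestFunction.enorm_le_lintegral_of_dim_one {Ω : Set (EuclideanSpace ℝ (Fin 1))}
    {φ : EuclideanSpace ℝ (Fin 1) → ℝ} (hφ : IsTestFunction Ω φ) (x : EuclideanSpace ℝ (Fin 1)) :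
    ‖φ x‖ₑ ≤ ∫⁻ y, ‖fderiv ℝ φ y‖ₑ := by
  let e := (OrthonormalBasis.singleton (Fin 1) ℝ).repr
  have he : MeasurePreserving e := (OrthonormalBasis.singleton (Fin 1) ℝ).measurePreserving_repr
  have h1 : ContDiff ℝ 1 (φ ∘ e) := (hφ.1.of_le (by simp)).comp e.contDiff
  have h2 : HasCompactSupport (φ ∘ e) := hφ.2.1.comp_homeomorph e.toHomeomorph
  calc ‖φ x‖ₑ = ‖(φ ∘ e) (e.symm x)‖ₑ := by simp
    _ ≤ ∫⁻ t in Set.Iic (e.symm x), ‖deriv (φ ∘ e) t‖ₑ := h2.enorm_le_lintegral_Ici_deriv h1 _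
    _ ≤ ∫⁻ t, ‖deriv (φ ∘ e) t‖ₑ := setLIntegral_le_lintegral _ _
    _ ≤ ∫⁻ t, ‖fderiv ℝ φ (e t)‖ₑ := by
        refine lintegral_mono fun t => ?_
        have h3 : deriv (φ ∘ e) t = fderiv ℝ φ (e t) (e 1) := by
          have h4 : HasDerivAt e (e 1) t := by
            simpa using (e : ℝ →L[ℝ] EuclideanSpace ℝ (Fin 1)).hasDerivAt (x := t)
          exact ((hφ.differentiable (e t)).hasFDerivAt.comp_hasDerivAt t h4).deriv
        rw [h3]
        rw [enorm_le_iff_norm_le]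
        have h5 : ‖e 1‖ = 1 := (e.norm_map (1 : ℝ)).trans norm_one
        simpa only [h5, mul_one] using (fderiv ℝ φ (e t)).le_opNorm (e 1)
    _ = ∫⁻ y, ‖fderiv ℝ φ y‖ₑ :=
        he.lintegral_comp (hφ.1.continuous_fderiv (by simp)).enorm.measurable

/-- The Sobolev embedding into `L^{2^*}`, outside the borderline dimension two. -/
lemma exists_sobolev (hN : 1 ≤ N) (hN2 : N ≠ 2) (hΩ : Bornology.IsBounded Ω) :
    ∃ C : ℝ≥0∞, C ≠ ⊤ ∧ ∀ φ : EuclideanSpace ℝ (Fin N) → ℝ, IsTestFunction Ω φ →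
      eLpNorm φ (criticalExponent N) (volume.restrict Ω)
        ≤ C * eLpNorm (gradient φ) 2 (volume.restrict Ω) := by
  by_cases h3 : 3 ≤ N
  · have hNr : (3 : ℝ) ≤ N := by exact_mod_cast h3
    refine ⟨SNormLESNormFDerivOfEqConst ℝ
      (volume : Measure (EuclideanSpace ℝ (Fin N))) (2 : NNReal),
      ENNReal.coe_ne_top, fun φ hφ => ?_⟩
    rw [hφ.eLpNorm_gradient_restrict]
    refine (eLpNorm_mono_measure _ Measure.restrict_le_self).trans ?_
    have := eLpNorm_le_eLpNorm_fderiv_of_eq (volume : Measure (EuclideanSpace ℝ (Fin N)))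
      (u := φ) (p := 2) (p' := (2 * (N : ℝ) / ((N : ℝ) - 2)).toNNReal)
      (hφ.1.of_le (by simp)) hφ.2.1 (by norm_num) (by simp; lia) (by
        rw [Real.coe_toNNReal _ (div_nonneg (by positivity) (by linarith))]
        have : (N : ℝ) - 2 ≠ 0 := by linarith
        simp
        field_simp)
    simpa [criticalExponent, h3, ENNReal.ofReal] using this
  · obtain rfl : N = 1 := by lia
    have hvol : volume Ω ≠ ⊤ := hΩ.measure_lt_top.ne
    refine ⟨volume Ω ^ (1 / 2 : ℝ), ENNReal.rpow_ne_top_of_nonneg (by norm_num) hvol,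
      fun φ hφ => ?_⟩
    have h1 : eLpNorm φ ⊤ (volume.restrict Ω) ≤ eLpNorm (gradient φ) 1 (volume.restrict Ω) := by
      rw [hφ.eLpNorm_gradient_restrict, eLpNorm_exponent_top, eLpNorm_one_eq_lintegral_enorm]
      exact eLpNormEssSup_le_of_ae_enorm_bound
        (.of_forall fun x => hφ.enorm_le_lintegral_of_dim_one x)
    have h2 := eLpNorm_le_eLpNorm_mul_rpow_measure_univ (μ := volume.restrict Ω)
      (f := gradient φ) (p := 1) (q := 2) (by norm_num)
      (hφ.memLp_gradient 2 _).aestronglyMeasurable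
    have h4 : (1 / (1 : ℝ≥0∞).toReal - 1 / (2 : ℝ≥0∞).toReal) = (1 / 2 : ℝ) := by norm_num
    rw [h4, Measure.restrict_apply_univ, mul_comm] at h2
    simpa [criticalExponent] using h1.trans h2

end Sobolev

/-! ### Pairs of an element of `H_0^1` and its gradient -/

section Pair

variable {N : ℕ} {Ω : Set (EuclideanSpace ℝ (Fin N))} {u : EuclideanSpace ℝ (Fin N) → ℝ}
  {G : EuclideanSpace ℝ (Fin N) → EuclideanSpace ℝ (Fin N)}

/-- `(u, G)` is the `L²(Ω)`-limit of pairs `(φ, ∇φ)` with `φ ∈ C_c^∞(Ω)`; equivalently,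
`u ∈ H_0^1(Ω)` and `G` is almost everywhere equal to its weak gradient. -/
def IsH10Pair (Ω : Set (EuclideanSpace ℝ (Fin N))) (u : EuclideanSpace ℝ (Fin N) → ℝ)
    (G : EuclideanSpace ℝ (Fin N) → EuclideanSpace ℝ (Fin N)) : Prop :=
  MemLp u 2 (volume.restrict Ω) ∧ MemLp G 2 (volume.restrict Ω) ∧
    ∃ φ : ℕ → EuclideanSpace ℝ (Fin N) → ℝ, (∀ n, IsTestFunction Ω (φ n)) ∧
      Tendsto (fun n => eLpNorm (fun x => φ n x - u x) 2 (volume.restrict Ω)) atTop (𝓝 0) ∧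
      Tendsto (fun n => eLpNorm (fun x => gradient (φ n) x - G x) 2
        (volume.restrict Ω)) atTop (𝓝 0)

/-- The approximating test functions may be taken to converge almost everywhere. -/
lemma IsH10Pair.exists_seq_tendsto_ae (h : IsH10Pair Ω u G) :
    ∃ φ : ℕ → EuclideanSpace ℝ (Fin N) → ℝ, (∀ n, IsTestFunction Ω (φ n)) ∧
      Tendsto (fun n => eLpNorm (fun x => φ n x - u x) 2 (volume.restrict Ω)) atTop (𝓝 0) ∧
      Tendsto (fun n => eLpNorm (fun x => gradient (φ n) x - G x) 2
        (volume.restrict Ω)) atTop (𝓝 0) ∧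
      ∀ᵐ x ∂(volume.restrict Ω), Tendsto (fun n => φ n x) atTop (𝓝 (u x)) := by
  obtain ⟨hu, hG, φ, hφ, h1, h2⟩ := h
  obtain ⟨k, hk, hae⟩ := (tendstoInMeasure_of_tendsto_eLpNorm (by simp)
    (fun n => ((hφ n).memLp 2 _).aestronglyMeasurable) hu.aestronglyMeasurable
    h1).exists_seq_tendsto_ae
  exact ⟨fun n => φ (k n), fun n => hφ _, h1.comp hk.tendsto_atTop,
    h2.comp hk.tendsto_atTop, hae⟩

lemma integrable_bilin_of_memLp_two {α E F K : Type*} [MeasurableSpace α] {μ : Measure α}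
    [NormedAddCommGroup E] [NormedSpace ℝ E] [NormedAddCommGroup F] [NormedSpace ℝ F]
    [NormedAddCommGroup K] [NormedSpace ℝ K] (B : E →L[ℝ] F →L[ℝ] K) {w : α → E} {v : α → F}
    (hw : MemLp w 2 μ) (hv : MemLp v 2 μ) : Integrable (fun x => B (w x) (v x)) μ :=
  memLp_one_iff_integrable.1 (hw.of_bilin (r := 1) (fun a b => B a b) ‖B‖₊ hv
    (B.aestronglyMeasurable_comp₂ hw.aestronglyMeasurable hv.aestronglyMeasurable)
    (.of_forall fun _ => B.le_opNorm₂ _ _))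

/-- Strong convergence in `L²` passes to integrals against a fixed `L²` factor. -/
lemma tendsto_integral_bilin_of_tendsto_eLpNorm {α E F K : Type*} [MeasurableSpace α]
    {μ : Measure α}
    [NormedAddCommGroup E] [NormedSpace ℝ E] [NormedAddCommGroup F] [NormedSpace ℝ F]
    [NormedAddCommGroup K] [NormedSpace ℝ K] (B : E →L[ℝ] F →L[ℝ] K) {w : α → E} {V : ℕ → α → F}
    {v : α → F} (hw : MemLp w 2 μ) (hV : ∀ n, MemLp (V n) 2 μ) (hv : MemLp v 2 μ)
    (h : Tendsto (fun n => eLpNorm (fun x => V n x - v x) 2 μ) atTop (𝓝 0)) :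
    Tendsto (fun n => eLpNorm (fun x => B (w x) (V n x) - B (w x) (v x)) 1 μ) atTop (𝓝 0) ∧
    Tendsto (fun n => ∫ x, B (w x) (V n x) ∂μ) atTop (𝓝 (∫ x, B (w x) (v x) ∂μ)) := by
  have key : Tendsto (fun n => eLpNorm (fun x => B (w x) (V n x) - B (w x) (v x)) 1 μ) atTop
      (𝓝 0) := by
    have hlim : Tendsto (fun n => ‖B‖₊ * eLpNorm w 2 μ * eLpNorm (fun x => V n x - v x) 2 μ)
        atTop (𝓝 0) := by
      have := ENNReal.Tendsto.const_mul (a := ‖B‖₊ * eLpNorm w 2 μ) h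
        (Or.inr (ENNReal.mul_ne_top (by simp) hw.eLpNorm_ne_top))
      simpa using this
    refine tendsto_of_tendsto_of_tendsto_of_le_of_le tendsto_const_nhds hlim
      (fun n => zero_le) fun n => ?_
    have : eLpNorm (fun x => B (w x) ((V n - v) x)) 1 μ
        ≤ ‖B‖₊ * eLpNorm w 2 μ * eLpNorm (fun x => V n x - v x) 2 μ :=
      eLpNorm_le_eLpNorm_mul_eLpNorm_of_nnnorm (p := 2) (q := 2) (r := 1) (μ := μ)
      hw.aestronglyMeasurable ((hV n).sub hv).aestronglyMeasurable (fun a b => B a b) ‖B‖₊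
      (.of_forall fun x => B.le_opNorm₂ _ _)
    simpa only [Pi.sub_apply, map_sub] using this
  exact ⟨key, tendsto_integral_of_L1' _ (integrable_bilin_of_memLp_two B hw hv).aestronglyMeasurable
    (.of_forall fun n => integrable_bilin_of_memLp_two B hw (hV n)) key⟩

lemma IsTestFunction.setIntegral_smul_gradient {φ ψ : EuclideanSpace ℝ (Fin N) → ℝ}
    (hφ : IsTestFunction Ω φ) (hψ : IsTestFunction Ω ψ) :
    ∫ x in Ω, ψ x • gradient φ x = -∫ x in Ω, φ x • gradient ψ x := by
  have h1 : Integrable (fun x => ψ x • gradient φ x) (volume.restrict Ω) :=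
    memLp_one_iff_integrable.1 ((hφ.memLp_gradient 2 _).smul (hψ.memLp 2 _))
  have h2 : Integrable (fun x => φ x • gradient ψ x) (volume.restrict Ω) :=
    memLp_one_iff_integrable.1 ((hψ.memLp_gradient 2 _).smul (hφ.memLp 2 _))
  refine ext_inner_left ℝ fun v => ?_
  rw [inner_neg_right, ← integral_inner h1, ← integral_inner h2]
  simp only [real_inner_comm _ v, real_inner_smul_left, inner_gradient_eq_fderiv]
  rw [hφ.setIntegral_mul_fderiv hψ.1]
  simp only [mul_comm]

lemma IsH10Pair.hasWeakGradient (h : IsH10Pair Ω u G) :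
    HasWeakGradient Ω u G := by
  obtain ⟨hu, hG, φ, hφ, h1, h2⟩ := h
  have hloc : ∀ {E : Type} [NormedAddCommGroup E] {g : EuclideanSpace ℝ (Fin N) → E},
      MemLp g 2 (volume.restrict Ω) → LocallyIntegrableOn g Ω := by
    intro E _ g hg
    exact locallyIntegrableOn_of_locallyIntegrable_restrict (hg.locallyIntegrable (by norm_num))
  refine ⟨hloc hu, hloc hG, fun ψ hψ => ?_⟩
  have l1 := (tendsto_integral_bilin_of_tendsto_eLpNorm
    (ContinuousLinearMap.lsmul ℝ ℝ (E := EuclideanSpace ℝ (Fin N))).flip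
    (hψ.memLp_gradient 2 _) (fun n => (hφ n).memLp 2 _) hu h1).2
  have l2 := (tendsto_integral_bilin_of_tendsto_eLpNorm
    (ContinuousLinearMap.lsmul ℝ ℝ (E := EuclideanSpace ℝ (Fin N)))
    (hψ.memLp 2 _) (fun n => (hφ n).memLp_gradient 2 _) hG h2).2
  refine tendsto_nhds_unique l1 (l2.neg.congr fun n => ?_)
  exact (hψ.setIntegral_smul_gradient (hφ n)).symm

lemma HasWeakGradient.ae_eq (hΩ : IsOpen Ω)
    {G' : EuclideanSpace ℝ (Fin N) → EuclideanSpace ℝ (Fin N)}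
    (h : HasWeakGradient Ω u G) (h' : HasWeakGradient Ω u G') :
    G =ᵐ[volume.restrict Ω] G' := by
  have hi : ∀ {g : EuclideanSpace ℝ (Fin N) → EuclideanSpace ℝ (Fin N)},
      LocallyIntegrableOn g Ω → ∀ ψ, IsTestFunction Ω ψ →
      IntegrableOn (fun x => ψ x • g x) Ω := by
    intro g hg ψ hψ
    have h1 := (hg.integrableOn_compact_subset hψ.2.2 hψ.2.1).continuousOn_smul
      hψ.1.continuous.continuousOn hψ.2.1
    refine Integrable.integrableOn ((integrableOn_iff_integrable_of_support_subset ?_).1 h1)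
    exact (Function.support_smul_subset_left ψ g).trans (subset_tsupport ψ)
  have := hΩ.ae_eq_zero_of_integral_contDiff_smul_eq_zero (f := fun x => G x - G' x)
    (μ := volume) (h.2.1.sub h'.2.1) fun ψ h1 h2 h3 => by
      have hψ : IsTestFunction Ω ψ := ⟨h1, h2, h3⟩
      rw [← setIntegral_eq_integral_of_forall_compl_eq_zero (s := Ω) fun x hx => by
        simp [hψ.eq_zero_of_notMem hx]]
      simp only [smul_sub]
      rw [integral_sub (hi h.2.1 ψ hψ) (hi h'.2.1 ψ hψ), sub_eq_zero]
      exact neg_injective ((h.2.2 ψ hψ).symm.trans (h'.2.2 ψ hψ))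
  rw [Filter.EventuallyEq, ae_restrict_iff' hΩ.measurableSet]
  filter_upwards [this] with x hx hxΩ
  exact sub_eq_zero.1 (hx hxΩ)

lemma IsH10Pair.weakGradient_ae_eq (hΩ : IsOpen Ω) (h : IsH10Pair Ω u G) :
    weakGradient Ω u =ᵐ[volume.restrict Ω] G := by
  have hex : ∃ G, HasWeakGradient Ω u G := ⟨G, h.hasWeakGradient⟩
  rw [weakGradient, dif_pos hex]
  exact hex.choose_spec.ae_eq hΩ h.hasWeakGradient

lemma IsH10Pair.memH10 (hΩ : IsOpen Ω) (h : IsH10Pair Ω u G) : MemH10 Ω u := by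
  obtain ⟨φ, hφ, h1, h2⟩ := h.2.2
  refine ⟨⟨h.1, G, h.hasWeakGradient, h.2.1⟩, φ, hφ, h1, h2.congr fun n => ?_⟩
  refine eLpNorm_congr_ae ?_
  filter_upwards [h.weakGradient_ae_eq hΩ] with x hx
  rw [hx]

lemma MemH10.isH10Pair (hΩ : IsOpen Ω) (h : MemH10 Ω u) :
    IsH10Pair Ω u (weakGradient Ω u) := by
  obtain ⟨⟨hu, G, hG, hG2⟩, h'⟩ := h
  have hex : ∃ G, HasWeakGradient Ω u G := ⟨G, hG⟩
  have hae : weakGradient Ω u =ᵐ[volume.restrict Ω] G := by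
    rw [weakGradient, dif_pos hex]
    exact hex.choose_spec.ae_eq hΩ hG
  exact ⟨hu, (memLp_congr_ae hae).2 hG2, h'⟩

lemma IsH10Pair.h10Norm_sq (hΩ : IsOpen Ω) (h : IsH10Pair Ω u G) :
    h10Norm Ω u ^ 2 = ∫ x in Ω, ‖G x‖ ^ 2 := by
  rw [h10Norm, Real.sq_sqrt (integral_nonneg fun x => by positivity)]
  refine integral_congr_ae ?_
  filter_upwards [h.weakGradient_ae_eq hΩ] with x hx
  rw [hx]

lemma IsH10Pair.const_smul (h : IsH10Pair Ω u G) (c : ℝ) :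
    IsH10Pair Ω (fun x => c * u x) (fun x => c • G x) := by
  obtain ⟨hu, hG, φ, hφ, h1, h2⟩ := h
  refine ⟨hu.const_mul c, hG.const_smul c, fun n => c • φ n, fun n => (hφ n).const_smul c, ?_, ?_⟩
  · have := ENNReal.Tendsto.const_mul (a := ‖c‖ₑ) h1 (Or.inr enorm_ne_top)
    rw [mul_zero] at this
    refine this.congr fun n => ?_
    rw [← eLpNorm_const_smul]
    congr 1
    ext x
    simp [mul_sub]
  · have := ENNReal.Tendsto.const_mul (a := ‖c‖ₑ) h2 (Or.inr enorm_ne_top)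
    rw [mul_zero] at this
    refine this.congr fun n => ?_
    rw [← eLpNorm_const_smul]
    congr 1
    ext1 x
    simp [(hφ n).gradient_const_smul, smul_sub]

/-- Products of `L^{2^*/(2^*-1)}` functions with elements of `H_0^1` are integrable. -/
lemma IsH10Pair.integrable_mul (hN : 1 ≤ N) (hN2 : N ≠ 2) (hΩ : Bornology.IsBounded Ω)
    (h : IsH10Pair Ω u G) {f : EuclideanSpace ℝ (Fin N) → ℝ}
    (hf : MemLp f (dualCriticalExponent N) (volume.restrict Ω)) :
    Integrable (fun x => f x * u x) (volume.restrict Ω) := by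
  have hconj := holderConjugate_criticalExponent N
  obtain ⟨φ, hφ, h1, h2, h3⟩ := h.exists_seq_tendsto_ae
  obtain ⟨C, hC, hS⟩ := exists_sobolev hN hN2 hΩ
  suffices hu : MemLp u (criticalExponent N) (volume.restrict Ω) from
    have := hconj.symm
    hf.integrable_mul hu
  refine ⟨h.1.aestronglyMeasurable, ?_⟩
  refine lt_of_le_of_lt (Lp.eLpNorm_le_of_ae_tendsto (C := C * (1 + eLpNorm G 2 _)) ?_
    (fun n => ((hφ n).memLp 2 _).aestronglyMeasurable) h3)
    (ENNReal.mul_lt_top hC.lt_top (ENNReal.add_lt_top.2 ⟨by simp, h.2.1.2⟩))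
  filter_upwards [h2.eventually (ge_mem_nhds (show (0 : ℝ≥0∞) < 1 by simp))] with n hn
  refine (hS _ (hφ n)).trans ?_
  gcongr
  calc eLpNorm (gradient (φ n)) 2 (volume.restrict Ω)
      = eLpNorm ((fun x => gradient (φ n) x - G x) + G) 2 (volume.restrict Ω) := by
        congr 1
        ext1 x
        simp
    _ ≤ _ := eLpNorm_add_le (((hφ n).memLp_gradient 2 _).sub h.2.1).aestronglyMeasurable
        h.2.1.aestronglyMeasurable (by norm_num)
    _ ≤ _ := by gcongr

end Pair

/-! ### `H_0^1` as a Hilbert space and the linear Dirichlet problem -/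

section Hilbert

variable {N : ℕ} {Ω : Set (EuclideanSpace ℝ (Fin N))}

/-- The ambient Hilbert space `L²(Ω) × L²(Ω)^N` of pairs (function, gradient). -/
abbrev L2Pair (Ω : Set (EuclideanSpace ℝ (Fin N))) : Type :=
  WithLp 2 (Lp ℝ 2 (volume.restrict Ω) × Lp (EuclideanSpace ℝ (Fin N)) 2 (volume.restrict Ω))

/-- The pairs `(φ, ∇φ)` with `φ ∈ C_c^∞(Ω)`, as a subspace of `L²(Ω) × L²(Ω)^N`. -/
noncomputable def testPairs (Ω : Set (EuclideanSpace ℝ (Fin N))) : Submodule ℝ (L2Pair Ω) where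
  carrier := {p | ∃ φ, IsTestFunction Ω φ ∧ p.fst =ᵐ[volume.restrict Ω] φ ∧
    p.snd =ᵐ[volume.restrict Ω] gradient φ}
  zero_mem' := ⟨0, .zero, Lp.coeFn_zero _ _ _, by
    have : gradient (0 : EuclideanSpace ℝ (Fin N) → ℝ) = 0 := by
      ext1 x
      simp [gradient]
    rw [this]
    exact Lp.coeFn_zero _ _ _⟩
  add_mem' := by
    rintro p q ⟨φ, hφ, h1, h2⟩ ⟨ψ, hψ, h3, h4⟩
    refine ⟨φ + ψ, hφ.add hψ, (Lp.coeFn_add _ _).trans (h1.add h3), ?_⟩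
    rw [hφ.gradient_add hψ]
    exact (Lp.coeFn_add _ _).trans (h2.add h4)
  smul_mem' := by
    rintro c p ⟨φ, hφ, h1, h2⟩
    refine ⟨c • φ, hφ.const_smul c, (Lp.coeFn_smul _ _).trans (h1.const_smul c), ?_⟩
    rw [hφ.gradient_const_smul]
    exact (Lp.coeFn_smul _ _).trans (h2.const_smul c)

/-- The Hilbert space `H_0^1(Ω)`, as the closure of the pairs `(φ, ∇φ)` in
`L²(Ω) × L²(Ω)^N`. -/
noncomputable def h10Space (Ω : Set (EuclideanSpace ℝ (Fin N))) : Submodule ℝ (L2Pair Ω) :=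
  (testPairs Ω).topologicalClosure

instance : CompleteSpace (h10Space Ω) :=
  (Submodule.isClosed_topologicalClosure _).completeSpace_coe

lemma isH10Pair_of_mem_h10Space {p : L2Pair Ω} (hp : p ∈ h10Space Ω) :
    IsH10Pair Ω p.fst p.snd := by
  obtain ⟨q, hq, hlim⟩ := mem_closure_iff_seq_limit.1 hp
  choose φ hφ h1 h2 using hq
  have l1 : Tendsto (fun n => (q n).fst) atTop (𝓝 p.fst) :=
    ((WithLp.fstL 2 ℝ _ _).continuous.tendsto p).comp hlim
  have l2 : Tendsto (fun n => (q n).snd) atTop (𝓝 p.snd) :=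
    ((WithLp.sndL 2 ℝ _ _).continuous.tendsto p).comp hlim
  rw [Lp.tendsto_Lp_iff_tendsto_eLpNorm'] at l1 l2
  refine ⟨Lp.memLp _, Lp.memLp _, φ, hφ, l1.congr fun n => ?_, l2.congr fun n => ?_⟩
  · exact eLpNorm_congr_ae ((h1 n).sub .rfl)
  · exact eLpNorm_congr_ae ((h2 n).sub .rfl)

lemma IsH10Pair.exists_mem_h10Space {u : EuclideanSpace ℝ (Fin N) → ℝ}
    {G : EuclideanSpace ℝ (Fin N) → EuclideanSpace ℝ (Fin N)} (h : IsH10Pair Ω u G) :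
    ∃ p ∈ h10Space Ω, p.fst =ᵐ[volume.restrict Ω] u ∧ p.snd =ᵐ[volume.restrict Ω] G := by
  obtain ⟨hu, hG, φ, hφ, h1, h2⟩ := h
  refine ⟨WithLp.toLp 2 (hu.toLp u, hG.toLp G), ?_, hu.coeFn_toLp, hG.coeFn_toLp⟩
  refine mem_closure_iff_seq_limit.2 ⟨fun n => WithLp.toLp 2
    (((hφ n).memLp 2 _).toLp _, ((hφ n).memLp_gradient 2 _).toLp _), fun n =>
      ⟨φ n, hφ n, ((hφ n).memLp 2 _).coeFn_toLp, ((hφ n).memLp_gradient 2 _).coeFn_toLp⟩, ?_⟩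
  refine ((WithLp.prod_continuous_toLp 2 _ _).tendsto _).comp (Tendsto.prodMk_nhds ?_ ?_)
  · exact (Lp.tendsto_Lp_iff_tendsto_eLpNorm'' _ (fun n => (hφ n).memLp 2 _) u hu).2 h1
  · exact (Lp.tendsto_Lp_iff_tendsto_eLpNorm'' _ (fun n => (hφ n).memLp_gradient 2 _) G hG).2 h2

lemma norm_sq_eq_integral_norm_sq {E : Type*} [NormedAddCommGroup E] [InnerProductSpace ℝ E]
    {μ : Measure (EuclideanSpace ℝ (Fin N))} (g : Lp E 2 μ) : ‖g‖ ^ 2 = ∫ x, ‖g x‖ ^ 2 ∂μ := by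
  rw [← real_inner_self_eq_norm_sq, L2.inner_def]
  simp only [real_inner_self_eq_norm_sq]

/-- The **Poincaré inequality** in `H_0^1(Ω)`. -/
lemma exists_poincare_h10Space (hN : 1 ≤ N) (hΩ : Bornology.IsBounded Ω) :
    ∃ C : ℝ, 0 ≤ C ∧ ∀ p ∈ h10Space Ω, ‖p.fst‖ ^ 2 ≤ C * ‖p.snd‖ ^ 2 := by
  obtain ⟨C, hC, h⟩ := exists_poincare hN hΩ
  refine ⟨C, hC, fun p hp => ?_⟩
  have hclosed : IsClosed {p : L2Pair Ω | ‖p.fst‖ ^ 2 ≤ C * ‖p.snd‖ ^ 2} :=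
    isClosed_le ((WithLp.fstL 2 ℝ _ _).continuous.norm.pow 2)
      (((WithLp.sndL 2 ℝ _ _).continuous.norm.pow 2).const_mul C)
  refine closure_minimal ?_ hclosed hp
  rintro q ⟨φ, hφ, h1, h2⟩
  have e1 : ∫ x in Ω, ‖q.fst x‖ ^ 2 = ∫ x in Ω, φ x ^ 2 := by
    refine integral_congr_ae ?_
    filter_upwards [h1] with x hx
    rw [hx, Real.norm_eq_abs, sq_abs]
  have e2 : ∫ x in Ω, ‖q.snd x‖ ^ 2 = ∫ x in Ω, ‖gradient φ x‖ ^ 2 := by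
    refine integral_congr_ae ?_
    filter_upwards [h2] with x hx
    rw [hx]
  change ‖q.fst‖ ^ 2 ≤ C * ‖q.snd‖ ^ 2
  rw [norm_sq_eq_integral_norm_sq, norm_sq_eq_integral_norm_sq, e1, e2]
  exact h φ hφ

/-- If `f v` is integrable for every `v ∈ H_0^1(Ω)`, then `v ↦ ∫ f v` is a bounded functional on
`H_0^1(Ω)`, by the closed graph theorem for `v ↦ f v` into `L¹(Ω)`. -/
lemma exists_clm_integral_mul {f : EuclideanSpace ℝ (Fin N) → ℝ}
    (hf : ∀ u G, IsH10Pair Ω u G → Integrable (fun x => f x * u x) (volume.restrict Ω)) :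
    ∃ ℓ : h10Space Ω →L[ℝ] ℝ, ∀ p : h10Space Ω, ℓ p = ∫ x in Ω, f x * p.1.fst x := by
  have hint : ∀ p : h10Space Ω, Integrable (fun x => f x * p.1.fst x) (volume.restrict Ω) :=
    fun p => hf _ _ (isH10Pair_of_mem_h10Space p.2)
  let T : h10Space Ω →ₗ[ℝ] Lp ℝ 1 (volume.restrict Ω) :=
    { toFun := fun p => (hint p).toL1 _
      map_add' := fun p q => by
        rw [← Integrable.toL1_add, Integrable.toL1_eq_toL1_iff]
        filter_upwards [Lp.coeFn_add p.1.fst q.1.fst] with x hx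
        change f x * (p.1.fst + q.1.fst : Lp ℝ 2 (volume.restrict Ω)) x
          = f x * p.1.fst x + f x * q.1.fst x
        rw [hx, Pi.add_apply, mul_add]
      map_smul' := fun c p => by
        rw [RingHom.id_apply, ← Integrable.toL1_smul, Integrable.toL1_eq_toL1_iff]
        filter_upwards [Lp.coeFn_smul c p.1.fst] with x hx
        change f x * (c • p.1.fst : Lp ℝ 2 (volume.restrict Ω)) x = c • (f x * p.1.fst x)
        rw [hx, Pi.smul_apply, smul_eq_mul, smul_eq_mul]
        ring }
  have hT : Continuous T := by
    refine T.continuous_of_seq_closed_graph fun p q y hp hy => ?_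
    have l1 : Tendsto (fun n => (p n).1.fst) atTop (𝓝 q.1.fst) :=
      ((WithLp.fstL 2 ℝ _ _).continuous.comp continuous_subtype_val).continuousAt.tendsto.comp hp
    obtain ⟨k, hk, hae⟩ := (tendstoInMeasure_of_tendsto_Lp l1).exists_seq_tendsto_ae
    obtain ⟨j, hj, hae'⟩ := (tendstoInMeasure_of_tendsto_Lp
      (hy.comp hk.tendsto_atTop)).exists_seq_tendsto_ae
    refine Lp.ext (EventuallyEq.trans ?_ (hint q).coeFn_toL1.symm)
    have hall : ∀ᵐ x ∂(volume.restrict Ω), ∀ n, T (p n) x = f x * (p n).1.fst x :=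
      ae_all_iff.2 fun n => (hint (p n)).coeFn_toL1
    filter_upwards [hae, hae', hall] with x h1 h2 h3
    refine tendsto_nhds_unique h2 ?_
    refine ((h1.comp hj.tendsto_atTop).const_mul (f x)).congr fun n => ?_
    exact (h3 _).symm
  refine ⟨(L1.integralCLM (E := ℝ) (μ := volume.restrict Ω)).comp ⟨T, hT⟩, fun p => ?_⟩
  rw [integral_eq _ (hint p), L1.integral_eq]
  rfl

/-- The **linear Dirichlet problem**: there is `w ∈ H_0^1(Ω)` with gradient `W` such that
`∫ W · ∇v = ∫ f v` for every `v ∈ H_0^1(Ω)`. -/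
lemma exists_dirichlet (hN : 1 ≤ N) (hΩ : Bornology.IsBounded Ω)
    {f : EuclideanSpace ℝ (Fin N) → ℝ}
    (hf : ∀ u G, IsH10Pair Ω u G → Integrable (fun x => f x * u x) (volume.restrict Ω)) :
    ∃ w W, IsH10Pair Ω w W ∧ ∀ v V, IsH10Pair Ω v V →
      ∫ x in Ω, inner ℝ (W x) (V x) = ∫ x in Ω, f x * v x := by
  obtain ⟨ℓ, hℓ⟩ := exists_clm_integral_mul hf
  obtain ⟨C, hC, hpoin⟩ := exists_poincare_h10Space hN hΩ
  let S : h10Space Ω →L[ℝ] Lp (EuclideanSpace ℝ (Fin N)) 2 (volume.restrict Ω) :=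
    (WithLp.sndL 2 ℝ _ _).comp (h10Space Ω).subtypeL
  let B : h10Space Ω →L[ℝ] h10Space Ω →L[ℝ] ℝ := (innerSL ℝ).bilinearComp S S
  have hB : ∀ p q, B p q = inner ℝ p.1.snd q.1.snd := fun p q => rfl
  have hcoer : IsCoercive B := by
    refine ⟨(C + 1)⁻¹, by positivity, fun p => ?_⟩
    have h1 : ‖p‖ ^ 2 = ‖p.1.fst‖ ^ 2 + ‖p.1.snd‖ ^ 2 := WithLp.prod_norm_sq_eq_of_L2 p.1
    have h2 := hpoin p.1 p.2
    rw [hB, real_inner_self_eq_norm_sq, mul_assoc, inv_mul_le_iff₀ (by positivity), ← pow_two]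
    linarith
  let r := (InnerProductSpace.toDual ℝ (h10Space Ω)).symm ℓ
  let h := hcoer.continuousLinearEquivOfBilin.symm r
  have hsol : ∀ q, inner ℝ h.1.snd q.1.snd = ℓ q := fun q => by
    rw [← hB, ← hcoer.continuousLinearEquivOfBilin_apply]
    simp [h, r]
  refine ⟨h.1.fst, h.1.snd, isH10Pair_of_mem_h10Space h.2, fun v V hv => ?_⟩
  obtain ⟨q, hq, h1, h2⟩ := hv.exists_mem_h10Space
  have := hsol ⟨q, hq⟩
  rw [hℓ, L2.inner_def] at this
  calc ∫ x in Ω, inner ℝ (h.1.snd x) (V x) = ∫ x in Ω, inner ℝ (h.1.snd x) (q.snd x) := by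
        refine integral_congr_ae ?_
        filter_upwards [h2] with x hx
        rw [hx]
    _ = ∫ x in Ω, f x * q.fst x := this
    _ = _ := by
        refine integral_congr_ae ?_
        filter_upwards [h1] with x hx
        rw [hx]

end Hilbert

/-! ### Positivity of the solution of the linear problem -/

section Positivity

/-- Uniformly bounded, almost everywhere convergent factors may be multiplied with an
`L¹`-convergent sequence under the integral. -/
lemma tendsto_integral_mul_of_bdd_of_L1 {α : Type*} [MeasurableSpace α] {μ : Measure α}
    {m : ℕ → α → ℝ} {m₀ : α → ℝ} {F : ℕ → α → ℝ} {F₀ : α → ℝ} {C : ℝ}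
    (hm : ∀ n, AEStronglyMeasurable (m n) μ) (hC : ∀ n x, |m n x| ≤ C)
    (hlim : ∀ᵐ x ∂μ, Tendsto (fun n => m n x) atTop (𝓝 (m₀ x)))
    (hF : ∀ n, Integrable (F n) μ) (hF₀ : Integrable F₀ μ)
    (h : Tendsto (fun n => eLpNorm (fun x => F n x - F₀ x) 1 μ) atTop (𝓝 0)) :
    Tendsto (fun n => ∫ x, m n x * F n x ∂μ) atTop (𝓝 (∫ x, m₀ x * F₀ x ∂μ)) := by
  have hi1 : ∀ n, Integrable (fun x => m n x * (F n x - F₀ x)) μ := fun n =>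
    ((hF n).sub hF₀).bdd_mul (hm n) (.of_forall (hC n))
  have hi2 : ∀ n, Integrable (fun x => m n x * F₀ x) μ := fun n =>
    hF₀.bdd_mul (hm n) (.of_forall (hC n))
  have l1 : Tendsto (fun n => ∫ x, m n x * (F n x - F₀ x) ∂μ) atTop (𝓝 (∫ _, (0 : ℝ) ∂μ)) := by
    refine tendsto_integral_of_L1' _ aestronglyMeasurable_const (.of_forall hi1) ?_
    have := ENNReal.Tendsto.const_mul (a := ENNReal.ofReal C) h (Or.inr ENNReal.ofReal_ne_top)
    rw [mul_zero] at this
    refine tendsto_of_tendsto_of_tendsto_of_le_of_le tendsto_const_nhds this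
      (fun n => zero_le) fun n => ?_
    refine eLpNorm_le_mul_eLpNorm_of_ae_le_mul (.of_forall fun x => ?_) 1
    rw [Pi.sub_apply, sub_zero, norm_mul]
    exact mul_le_mul_of_nonneg_right (hC n x) (norm_nonneg _)
  have l2 : Tendsto (fun n => ∫ x, m n x * F₀ x ∂μ) atTop (𝓝 (∫ x, m₀ x * F₀ x ∂μ)) := by
    refine tendsto_integral_of_dominated_convergence (fun x => C * ‖F₀ x‖)
      (fun n => (hi2 n).aestronglyMeasurable) (hF₀.norm.const_mul C)
      (fun n => .of_forall fun x => ?_) ?_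
    · rw [norm_mul]
      exact mul_le_mul_of_nonneg_right (hC n x) (norm_nonneg _)
    · filter_upwards [hlim] with x hx
      exact hx.mul_const _
  have l3 := l1.add l2
  rw [integral_zero, zero_add] at l3
  refine l3.congr fun n => ?_
  rw [← integral_add (hi1 n) (hi2 n)]
  refine integral_congr_ae (.of_forall fun x => ?_)
  change m n x * (F n x - F₀ x) + m n x * F₀ x = m n x * F n x
  ring

variable {N : ℕ} {Ω : Set (EuclideanSpace ℝ (Fin N))}
  {f w : EuclideanSpace ℝ (Fin N) → ℝ}
  {W : EuclideanSpace ℝ (Fin N) → EuclideanSpace ℝ (Fin N)}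

lemma IsTestFunction.isH10Pair {φ : EuclideanSpace ℝ (Fin N) → ℝ} (hφ : IsTestFunction Ω φ) :
    IsH10Pair Ω φ (gradient φ) :=
  ⟨hφ.memLp 2 _, hφ.memLp_gradient 2 _, fun _ => φ, fun _ => hφ, by simp, by simp⟩

/-- Testing the equation with `ζ g(w)`, without using that `ζ g(w) ∈ H_0^1(Ω)`: the equation is
tested with `ζ g(φ_n)`, where `φ_n` are test functions approximating `w`. -/
lemma integral_mul_comp_eq (hw : IsH10Pair Ω w W)
    (hf : Integrable f (volume.restrict Ω))
    (hsol : ∀ v V, IsH10Pair Ω v V → ∫ x in Ω, inner ℝ (W x) (V x) = ∫ x in Ω, f x * v x)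
    {g : ℝ → ℝ} (hg : ContDiff ℝ ∞ g) {C : ℝ} (hgC : ∀ s, |g s| ≤ C) {C' : ℝ}
    (hgC' : ∀ s, |deriv g s| ≤ C') {ζ : EuclideanSpace ℝ (Fin N) → ℝ} (hζ : ContDiff ℝ ∞ ζ)
    {D : ℝ} (hζD : ∀ x, |ζ x| ≤ D) (hζ' : MemLp (gradient ζ) 2 (volume.restrict Ω))
    (htest : ∀ φ, IsTestFunction Ω φ → IsTestFunction Ω (fun x => ζ x * g (φ x))) :
    Integrable (fun x => ζ x * deriv g (w x) * ‖W x‖ ^ 2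
        + g (w x) * inner ℝ (W x) (gradient ζ x)) (volume.restrict Ω) ∧
    ∫ x in Ω, ζ x * g (w x) * f x
      = ∫ x in Ω, (ζ x * deriv g (w x) * ‖W x‖ ^ 2 + g (w x) * inner ℝ (W x) (gradient ζ x)) := by
  obtain ⟨φ, hφ, -, h2, h3⟩ := hw.exists_seq_tendsto_ae
  have hg' : Continuous (deriv g) := hg.continuous_deriv (by simp)
  have hD : 0 ≤ D := (abs_nonneg _).trans (hζD 0)
  have hWm := hw.2.1
  have hinner : ∀ {V : EuclideanSpace ℝ (Fin N) → EuclideanSpace ℝ (Fin N)},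
      MemLp V 2 (volume.restrict Ω) →
      Integrable (fun x => inner ℝ (W x) (V x)) (volume.restrict Ω) := fun hV =>
    integrable_bilin_of_memLp_two (innerSL ℝ) hWm hV
  have hsq : Integrable (fun x => ‖W x‖ ^ 2) (volume.restrict Ω) :=
    hWm.integrable_norm_pow (by simp)
  have ha1 : ∀ n x, |ζ x * g (φ n x)| ≤ D * C := fun n x => by
    rw [abs_mul]
    exact mul_le_mul (hζD x) (hgC _) (abs_nonneg _) hD
  have ha2 : ∀ n x, |ζ x * deriv g (φ n x)| ≤ D * C' := fun n x => by
    rw [abs_mul]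
    exact mul_le_mul (hζD x) (hgC' _) (abs_nonneg _) hD
  have hm1 : ∀ n, Continuous (fun x => ζ x * g (φ n x)) := fun n =>
    hζ.continuous.mul (hg.continuous.comp (hφ n).1.continuous)
  have hm2 : ∀ n, Continuous (fun x => ζ x * deriv g (φ n x)) := fun n =>
    hζ.continuous.mul (hg'.comp (hφ n).1.continuous)
  have hm3 : ∀ n, Continuous (fun x => g (φ n x)) := fun n =>
    hg.continuous.comp (hφ n).1.continuous
  have l1 : Tendsto (fun n => ∫ x in Ω, ζ x * g (φ n x) * f x) atTop
      (𝓝 (∫ x in Ω, ζ x * g (w x) * f x)) :=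
    tendsto_integral_mul_of_bdd_of_L1 (fun n => (hm1 n).aestronglyMeasurable) ha1
      (by
        filter_upwards [h3] with x hx
        exact ((hg.continuous.tendsto _).comp hx).const_mul _)
      (fun _ => hf) hf (by simp)
  have l2 : Tendsto (fun n => ∫ x in Ω, ζ x * deriv g (φ n x) * inner ℝ (W x) (gradient (φ n) x))
      atTop (𝓝 (∫ x in Ω, ζ x * deriv g (w x) * ‖W x‖ ^ 2)) := by
    refine tendsto_integral_mul_of_bdd_of_L1 (fun n => (hm2 n).aestronglyMeasurable) ha2
      (by
        filter_upwards [h3] with x hx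
        exact ((hg'.tendsto _).comp hx).const_mul _)
      (fun n => hinner ((hφ n).memLp_gradient 2 _)) hsq ?_
    have := (tendsto_integral_bilin_of_tendsto_eLpNorm (innerSL ℝ) hWm
      (fun n => (hφ n).memLp_gradient 2 _) hWm h2).1
    simp only [← real_inner_self_eq_norm_sq]
    exact this
  have l3 : Tendsto (fun n => ∫ x in Ω, g (φ n x) * inner ℝ (W x) (gradient ζ x))
      atTop (𝓝 (∫ x in Ω, g (w x) * inner ℝ (W x) (gradient ζ x))) :=
    tendsto_integral_mul_of_bdd_of_L1 (fun n => (hm3 n).aestronglyMeasurable) (fun n x => hgC _)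
      (by
        filter_upwards [h3] with x hx
        exact (hg.continuous.tendsto _).comp hx)
      (fun n => hinner hζ') (hinner hζ') (by simp)
  have hwm : AEStronglyMeasurable w (volume.restrict Ω) := hw.1.aestronglyMeasurable
  have hi2 : Integrable (fun x => ζ x * deriv g (w x) * ‖W x‖ ^ 2) (volume.restrict Ω) := by
    refine hsq.bdd_mul (c := D * C') (hζ.continuous.aestronglyMeasurable.mul
      (hg'.comp_aestronglyMeasurable hwm)) (.of_forall fun x => ?_)
    rw [norm_mul]
    exact mul_le_mul (hζD x) (hgC' _) (abs_nonneg _) hD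
  have hi3 : Integrable (fun x => g (w x) * inner ℝ (W x) (gradient ζ x))
      (volume.restrict Ω) :=
    (hinner hζ').bdd_mul (hg.continuous.comp_aestronglyMeasurable hwm)
      (.of_forall fun x => hgC _)
  refine ⟨hi2.add hi3, ?_⟩
  rw [integral_add hi2 hi3]
  refine tendsto_nhds_unique l1 ((l2.add l3).congr fun n => ?_)
  have hn := hsol _ _ (htest _ (hφ n)).isH10Pair
  rw [← integral_add ((hinner ((hφ n).memLp_gradient 2 _)).bdd_mul
      (hm2 n).aestronglyMeasurable (.of_forall (ha2 n)))
    ((hinner hζ').bdd_mul (hm3 n).aestronglyMeasurable (.of_forall fun x => hgC _))]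
  calc _ = ∫ x in Ω, inner ℝ (W x) (gradient (fun y => ζ y * g (φ n y)) x) := by
        refine integral_congr_ae (.of_forall fun x => ?_)
        change _ = inner ℝ (W x) (gradient (fun y => ζ y * g (φ n y)) x)
        rw [gradient_mul_comp (hζ.differentiable (by simp) x) (hg.differentiable (by simp) _)
          ((hφ n).differentiable x), inner_add_right, inner_smul_right, inner_smul_right]
    _ = _ := by
        rw [hn]
        refine integral_congr_ae (.of_forall fun x => ?_)
        exact mul_comm _ _

lemma exists_abs_deriv_smoothTransition_le :
    ∃ C : ℝ, ∀ s, |deriv Real.smoothTransition s| ≤ C := by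
  have hcont : Continuous (deriv Real.smoothTransition) :=
    (Real.smoothTransition.contDiff (n := 1)).continuous_deriv le_rfl
  obtain ⟨C, hC⟩ := isCompact_Icc.exists_bound_of_continuousOn
    (s := Set.Icc (0 : ℝ) 1) hcont.continuousOn
  refine ⟨C, fun s => ?_⟩
  by_cases hs : s ∈ Set.Icc (0 : ℝ) 1
  · exact hC s hs
  · have hC0 : 0 ≤ C := (norm_nonneg _).trans (hC 0 (by simp))
    suffices h : deriv Real.smoothTransition s = 0 by simpa [h] using hC0
    rcases lt_or_ge s 0 with h | h
    · have : Real.smoothTransition =ᶠ[𝓝 s] fun _ => 0 := by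
        filter_upwards [Iio_mem_nhds h] with t ht
        exact Real.smoothTransition.zero_of_nonpos (le_of_lt ht)
      rw [this.deriv_eq, deriv_const]
    · have h1 : 1 < s := by
        by_contra h'
        exact hs ⟨h, not_lt.1 h'⟩
      have : Real.smoothTransition =ᶠ[𝓝 s] fun _ => 1 := by
        filter_upwards [Ioi_mem_nhds h1] with t ht
        exact Real.smoothTransition.one_of_one_le (le_of_lt ht)
      rw [this.deriv_eq, deriv_const]

/-- The **weak maximum principle**, obtained by testing with `g(w)`, where `g` is bounded,
nondecreasing, negative on `(-∞, 0)` and zero on `[0, ∞)`. -/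
lemma ae_nonneg_of_dirichlet (hw : IsH10Pair Ω w W)
    (hf : Integrable f (volume.restrict Ω)) (hfpos : ∀ᵐ x ∂(volume.restrict Ω), 0 < f x)
    (hsol : ∀ v V, IsH10Pair Ω v V → ∫ x in Ω, inner ℝ (W x) (V x) = ∫ x in Ω, f x * v x) :
    ∀ᵐ x ∂(volume.restrict Ω), 0 ≤ w x := by
  obtain ⟨C, hC⟩ := exists_abs_deriv_smoothTransition_le
  let g : ℝ → ℝ := fun s => -Real.smoothTransition (-s)
  have hg : ContDiff ℝ ∞ g := (Real.smoothTransition.contDiff.comp contDiff_neg).neg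
  have hg1 : ∀ s, |g s| ≤ 1 := fun s => by
    rw [abs_neg, abs_of_nonneg (Real.smoothTransition.nonneg _)]
    exact Real.smoothTransition.le_one _
  have hderiv : ∀ s, deriv g s = deriv Real.smoothTransition (-s) := fun s => by
    simp [g, deriv_comp_neg]
  obtain ⟨-, hkey⟩ := integral_mul_comp_eq hw hf hsol hg hg1 (C' := C)
    (fun s => by rw [hderiv]; exact hC _) (ζ := fun _ => 1) contDiff_const (D := 1)
    (fun _ => by simp) (by simp)
    (fun φ hφ => by simpa using hφ.comp_left hg (by simp [g]))
  simp only [gradient_fun_const, inner_zero_right, mul_zero, add_zero, one_mul] at hkey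
  have hnonneg : 0 ≤ ∫ x in Ω, g (w x) * f x := by
    rw [hkey]
    refine integral_nonneg fun x => mul_nonneg ?_ (by positivity)
    rw [hderiv]
    exact Real.smoothTransition.monotone.deriv_nonneg
  have hi : Integrable (fun x => g (w x) * f x) (volume.restrict Ω) :=
    hf.bdd_mul (hg.continuous.comp_aestronglyMeasurable hw.1.aestronglyMeasurable)
      (.of_forall fun x => hg1 _)
  have h0 : 0 ≤ᵐ[volume.restrict Ω] fun x => -(g (w x) * f x) := by
    filter_upwards [hfpos] with x hx
    have : 0 ≤ Real.smoothTransition (-w x) := Real.smoothTransition.nonneg _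
    change 0 ≤ -(-Real.smoothTransition (-w x) * f x)
    nlinarith
  have hz : ∫ x in Ω, -(g (w x) * f x) = 0 := by
    refine le_antisymm ?_ (integral_nonneg_of_ae h0)
    rw [integral_neg]
    linarith
  filter_upwards [(integral_eq_zero_iff_of_nonneg_ae h0 hi.neg).1 hz, hfpos] with x hx hfx
  by_contra hneg
  have h1 : 0 < Real.smoothTransition (-w x) :=
    Real.smoothTransition.pos_of_pos (by linarith)
  have h2 : -(-Real.smoothTransition (-w x) * f x) = 0 := hx
  have h3 := mul_pos h1 hfx
  linarith

/-- The pointwise estimate behind the strong maximum principle: Young's inequality absorbs the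
cross term in the negative quadratic one. -/
lemma neg_sq_add_inner_le {E : Type*} [NormedAddCommGroup E] [InnerProductSpace ℝ E] (P Q : E)
    {e k q s : ℝ} (hk : 0 < k) (hq : 1 ≤ q) (he : 0 ≤ e) (he1 : e ≤ 1) :
    s * s * (-(k * e / q)) * ‖P‖ ^ 2 + e * inner ℝ P ((2 * s) • Q) ≤ k⁻¹ * (q * ‖Q‖ ^ 2) := by
  have hq0 : 0 < q := by linarith
  have h1 : inner ℝ P ((2 * s) • Q) ≤ 2 * (|s| * ‖P‖) * ‖Q‖ := by
    refine (real_inner_le_norm _ _).trans (le_of_eq ?_)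
    rw [norm_smul, norm_mul, Real.norm_eq_abs, Real.norm_eq_abs, abs_two]
    ring
  have h2 : 2 * (|s| * ‖P‖) * ‖Q‖ ≤ k / q * (|s| * ‖P‖) ^ 2 + q / k * ‖Q‖ ^ 2 := by
    have h := sq_nonneg (k * (|s| * ‖P‖) - q * ‖Q‖)
    rw [div_mul_eq_mul_div, div_mul_eq_mul_div, div_add_div _ _ hq0.ne' hk.ne',
      le_div_iff₀ (by positivity)]
    nlinarith
  have h3 : (|s| * ‖P‖) ^ 2 = s * s * ‖P‖ ^ 2 := by
    rw [mul_pow, sq_abs]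
    ring
  have h4 : q / k * ‖Q‖ ^ 2 * e ≤ q / k * ‖Q‖ ^ 2 * 1 :=
    mul_le_mul_of_nonneg_left he1 (by positivity)
  have h5 := mul_le_mul_of_nonneg_left (h1.trans h2) he
  rw [h3] at h5
  calc _ ≤ s * s * (-(k * e / q)) * ‖P‖ ^ 2
        + e * (k / q * (s * s * ‖P‖ ^ 2) + q / k * ‖Q‖ ^ 2) := by linarith
    _ = q / k * ‖Q‖ ^ 2 * e := by ring
    _ ≤ q / k * ‖Q‖ ^ 2 * 1 := h4
    _ = _ := by ring

/-- The solution cannot vanish where a test function `η` does not: testing with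
`η² exp(-k arctan w)` and using Young's inequality gives
`∫ f η² exp(-k arctan w) ≤ k⁻¹ ∫ (1 + w²) |∇η|²`, and the left side is at least
`∫_{w = 0} f η²` for every `k`. -/
lemma ae_ne_zero_of_test_ne_zero (hΩ : Bornology.IsBounded Ω) (hw : IsH10Pair Ω w W)
    (hf : Integrable f (volume.restrict Ω)) (hfpos : ∀ᵐ x ∂(volume.restrict Ω), 0 < f x)
    (hsol : ∀ v V, IsH10Pair Ω v V → ∫ x in Ω, inner ℝ (W x) (V x) = ∫ x in Ω, f x * v x)
    {η : EuclideanSpace ℝ (Fin N) → ℝ} (hη : IsTestFunction Ω η) :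
    ∀ᵐ x ∂(volume.restrict Ω), η x ≠ 0 → w x ≠ 0 := by
  have hnn := ae_nonneg_of_dirichlet hw hf hfpos hsol
  have hwm : AEStronglyMeasurable w (volume.restrict Ω) := hw.1.aestronglyMeasurable
  have hζt : IsTestFunction Ω (fun x => η x * η x) := hη.mul_left hη.1
  obtain ⟨D, hD⟩ := hζt.2.1.exists_bound_of_continuous hζt.1.continuous
  obtain ⟨D', hD'⟩ := hη.hasCompactSupport_gradient.exists_bound_of_continuous
    (continuous_gradient hη.1)
  have hζgrad : ∀ x, gradient (fun x => η x * η x) x = (2 * η x) • gradient η x := fun x => by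
    have := gradient_mul_comp (φ := η) (ζ := η) (g := id) (hη.differentiable x)
      differentiableAt_id (hη.differentiable x)
    simp only [id, deriv_id, mul_one] at this
    rw [this, ← add_smul, two_mul]
  have hA : Integrable (fun x => (1 + w x ^ 2) * ‖gradient η x‖ ^ 2) (volume.restrict Ω) := by
    have : IsFiniteMeasure (volume.restrict Ω) := ⟨by simpa using hΩ.measure_lt_top⟩
    refine ((integrable_const 1).add hw.1.integrable_sq).mul_bdd (c := D' ^ 2)
      ((continuous_gradient hη.1).norm.pow 2).aestronglyMeasurable (.of_forall fun x => ?_)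
    rw [norm_pow, norm_norm]
    exact pow_le_pow_left₀ (norm_nonneg _) (hD' x) 2
  -- The part of `f η²` living on `{w = 0}`.
  let J : EuclideanSpace ℝ (Fin N) → ℝ := fun x =>
    η x * η x * Set.indicator {0} (fun _ => (1 : ℝ)) (w x) * f x
  have hind : Measurable (Set.indicator ({0} : Set ℝ) (fun _ => (1 : ℝ))) :=
    measurable_const.indicator (measurableSet_singleton 0)
  have hJi : Integrable J (volume.restrict Ω) := by
    refine hf.bdd_mul (c := D) (hζt.1.continuous.aestronglyMeasurable.mul
      (hind.comp_aemeasurable hwm.aemeasurable).aestronglyMeasurable) (.of_forall fun x => ?_)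
    rw [norm_mul]
    have h1 : ‖Set.indicator ({0} : Set ℝ) (fun _ => (1 : ℝ)) (w x)‖ ≤ 1 :=
      (norm_indicator_le_norm_self _ _).trans (by simp)
    calc _ ≤ ‖η x * η x‖ * 1 := mul_le_mul_of_nonneg_left h1 (norm_nonneg _)
      _ ≤ D := by simpa using hD x
  have hJ0 : 0 ≤ᵐ[volume.restrict Ω] J := by
    filter_upwards [hfpos] with x hx
    exact mul_nonneg (mul_nonneg (mul_self_nonneg _)
      (Set.indicator_nonneg (fun _ _ => zero_le_one) _)) hx.le
  have hbound : ∀ k : ℕ, 0 < k →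
      ∫ x in Ω, J x ≤ (k : ℝ)⁻¹ * ∫ x in Ω, (1 + w x ^ 2) * ‖gradient η x‖ ^ 2 := by
    intro k hk
    have hk0 : (0 : ℝ) < k := by exact_mod_cast hk
    let g : ℝ → ℝ := fun s => Real.exp (-(k * Real.arctan s))
    have hg : ContDiff ℝ ∞ g :=
      Real.contDiff_exp.comp (contDiff_const.mul Real.contDiff_arctan).neg
    have hgle : ∀ s, |g s| ≤ Real.exp (k * 2) := fun s => by
      rw [Real.abs_exp]
      refine Real.exp_le_exp.2 ?_
      have := Real.neg_pi_div_two_lt_arctan s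
      have := Real.pi_le_four
      nlinarith
    have hderiv : ∀ s, deriv g s = -(k * g s / (1 + s ^ 2)) := fun s => by
      have h : HasDerivAt g _ s := ((Real.hasDerivAt_arctan s).const_mul (k : ℝ)).neg.exp
      rw [h.deriv]
      simp only [g, Pi.neg_apply]
      ring
    have hgle' : ∀ s, |deriv g s| ≤ k * Real.exp (k * 2) := fun s => by
      rw [hderiv, abs_neg, abs_div, abs_mul, abs_of_pos hk0,
        abs_of_pos (show (0 : ℝ) < 1 + s ^ 2 by positivity)]
      refine (div_le_self (by positivity) (by nlinarith [sq_nonneg s])).trans ?_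
      exact mul_le_mul_of_nonneg_left (hgle s) hk0.le
    obtain ⟨hkeyi, hkey⟩ := integral_mul_comp_eq hw hf hsol hg hgle hgle' hζt.1 hD
      (hζt.memLp_gradient 2 _) fun φ hφ => by
        have := hζt.mul_left (hg.comp hφ.1)
        simpa only [Function.comp, mul_comm] using this
    have hgi : Integrable (fun x => η x * η x * g (w x) * f x) (volume.restrict Ω) := by
      refine hf.bdd_mul (c := D * Real.exp (k * 2)) (hζt.1.continuous.aestronglyMeasurable.mul
        (hg.continuous.comp_aestronglyMeasurable hwm)) (.of_forall fun x => ?_)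
      rw [norm_mul]
      exact mul_le_mul (hD x) (hgle _) (abs_nonneg _) ((norm_nonneg _).trans (hD x))
    calc ∫ x in Ω, J x ≤ ∫ x in Ω, η x * η x * g (w x) * f x := by
          refine integral_mono_ae hJi hgi ?_
          filter_upwards [hfpos] with x hx
          refine mul_le_mul_of_nonneg_right (mul_le_mul_of_nonneg_left ?_ (mul_self_nonneg _)) hx.le
          by_cases h0 : w x = 0
          · simp [h0, g]
          · simpa [h0] using (Real.exp_pos _).le
      _ ≤ ∫ x in Ω, (k : ℝ)⁻¹ * ((1 + w x ^ 2) * ‖gradient η x‖ ^ 2) := by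
          rw [hkey]
          refine integral_mono_ae ?_ (hA.const_mul _) ?_
          · exact hkeyi
          · filter_upwards [hnn] with x hx
            rw [hderiv, hζgrad]
            refine neg_sq_add_inner_le _ _ hk0 (by nlinarith [sq_nonneg (w x)])
              (Real.exp_pos _).le ?_
            rw [Real.exp_le_one_iff, neg_nonpos]
            exact mul_nonneg hk0.le (Real.arctan_nonneg.2 hx)
      _ = _ := integral_const_mul _ _
  have hJle : ∫ x in Ω, J x ≤ 0 := by
    have hl : Tendsto (fun k : ℕ =>
        (k : ℝ)⁻¹ * ∫ x in Ω, (1 + w x ^ 2) * ‖gradient η x‖ ^ 2) atTop (𝓝 0) := by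
      simpa only [zero_mul] using (tendsto_inv_atTop_nhds_zero_nat (𝕜 := ℝ)).mul_const
        (∫ x in Ω, (1 + w x ^ 2) * ‖gradient η x‖ ^ 2)
    exact ge_of_tendsto hl ((eventually_gt_atTop 0).mono hbound)
  have hJz := (integral_eq_zero_iff_of_nonneg_ae hJ0 hJi).1
    (le_antisymm hJle (integral_nonneg_of_ae hJ0))
  filter_upwards [hJz, hfpos] with x hx hfx hηx hwx
  simp [J, hwx, hηx, hfx.ne'] at hx

/-- The **strong maximum principle**: a solution of `-Δw = f` with `f > 0` is positive. -/
lemma ae_pos_of_dirichlet (hΩo : IsOpen Ω) (hΩ : Bornology.IsBounded Ω) (hw : IsH10Pair Ω w W)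
    (hf : Integrable f (volume.restrict Ω)) (hfpos : ∀ᵐ x ∂(volume.restrict Ω), 0 < f x)
    (hsol : ∀ v V, IsH10Pair Ω v V → ∫ x in Ω, inner ℝ (W x) (V x) = ∫ x in Ω, f x * v x) :
    ∀ᵐ x ∂(volume.restrict Ω), 0 < w x := by
  have hne : ∀ᵐ x ∂volume, x ∈ Ω → w x ≠ 0 := by
    have hnull : volume {x | x ∈ Ω ∧ w x = 0} = 0 := by
      refine measure_null_of_locally_null _ fun x hx => ?_
      obtain ⟨r, hr, hball⟩ := Metric.isOpen_iff.1 hΩo x hx.1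
      let η : ContDiffBump x := ⟨r / 4, r / 2, by positivity, by linarith⟩
      have hη : IsTestFunction Ω η := by
        refine ⟨η.contDiff, η.hasCompactSupport, ?_⟩
        rw [η.tsupport_eq]
        exact (Metric.closedBall_subset_ball (by change r / 2 < r; linarith)).trans hball
      have h := (ae_restrict_iff' hΩo.measurableSet).1
        (ae_ne_zero_of_test_ne_zero hΩ hw hf hfpos hsol hη)
      refine ⟨Metric.ball x (r / 2) ∩ {x | x ∈ Ω ∧ w x = 0}, Filter.inter_mem
        (mem_nhdsWithin_of_mem_nhds (Metric.ball_mem_nhds x (by positivity)))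
        self_mem_nhdsWithin, ?_⟩
      · refine measure_mono_null ?_ h
        rintro y ⟨hy, hyΩ, hy0⟩ hcon
        exact hcon hyΩ (η.pos_of_mem_ball hy).ne' hy0
    rw [ae_iff]
    simpa using hnull
  filter_upwards [ae_nonneg_of_dirichlet hw hf hfpos hsol,
    (ae_restrict_iff' hΩo.measurableSet).2 hne] with x h1 h2
  exact lt_of_le_of_ne h1 (Ne.symm h2)

end Positivity

/-! ### The nonlocal problem -/

/-- The scaling `s` for which `-s w` solves the nonlocal problem, where `X = ‖w‖²`. -/
lemma exists_pos_cubic_eq {a b X μ : ℝ} (ha : 0 < a) (hb : 0 < b) (hX : 0 < X) (hμ : 0 < μ) :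
    ∃ s : ℝ, 0 < s ∧ s * (b * (s ^ 2 * X) - a) = μ := by
  have hbX : 0 < b * X := mul_pos hb hX
  set M : ℝ := 1 + (a + μ) / (b * X) with hM
  have hM1 : 1 ≤ M := by
    have : 0 < (a + μ) / (b * X) := by positivity
    linarith
  have hMX : b * X * M = b * X + (a + μ) := by
    rw [hM]
    field_simp
  have hcont : Continuous fun s : ℝ => s * (b * (s ^ 2 * X) - a) := by fun_prop
  have hend : μ ≤ M * (b * (M ^ 2 * X) - a) := by
    have h1 : b * X * M * 1 ≤ b * X * M * M :=
      mul_le_mul_of_nonneg_left hM1 (by positivity)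
    nlinarith
  obtain ⟨s, hs, hsμ⟩ := intermediate_value_Icc (by linarith : (0 : ℝ) ≤ M) hcont.continuousOn
    (show μ ∈ Set.Icc _ _ from ⟨by simpa using hμ.le, hend⟩)
  refine ⟨s, lt_of_le_of_ne hs.1 ?_, hsμ⟩
  rintro rfl
  simp only [zero_mul] at hsμ
  exact hμ.ne hsμ

theorem theorem3p5 (N : ℕ) (hN : 1 ≤ N) (Ω : Set (EuclideanSpace ℝ (Fin N)))
    (hΩo : IsOpen Ω) (hΩne : Ω.Nonempty) (hΩb : Bornology.IsBounded Ω)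
    (a b : ℝ) (ha : 0 < a) (hb : 0 < b)
    (f : EuclideanSpace ℝ (Fin N) → ℝ)
    (hf : MemLp f (dualCriticalExponent N) (volume.restrict Ω))
    (hfpos : ∀ᵐ x ∂(volume.restrict Ω), 0 < f x)
    (hf2 : N = 2 → ∀ v : EuclideanSpace ℝ (Fin N) → ℝ, MemH10 Ω v →
      IntegrableOn (fun x => f x * v x) Ω)
    (μ : ℝ) (hμ : 0 < μ) :
    ∃ u : EuclideanSpace ℝ (Fin N) → ℝ,
      IsWeakSolution Ω a b μ f u ∧
      (∀ᵐ x ∂(volume.restrict Ω), u x < 0) ∧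
      a ^ 2 / (4 * b) < energy Ω a b μ f u ∧
      a / b < h10Norm Ω u ^ 2 := by
  have hfin : IsFiniteMeasure (volume.restrict Ω) := ⟨by simpa using hΩb.measure_lt_top⟩
  have hfi : Integrable f (volume.restrict Ω) := hf.integrable le_self_add
  have hprod : ∀ u G, IsH10Pair Ω u G →
      Integrable (fun x => f x * u x) (volume.restrict Ω) := fun u G h => by
    by_cases hN2 : N = 2
    · exact hf2 hN2 u (h.memH10 hΩo)
    · exact h.integrable_mul hN hN2 hΩb hf
  obtain ⟨w, W, hw, hsol⟩ := exists_dirichlet hN hΩb hprod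
  have hwpos := ae_pos_of_dirichlet hΩo hΩb hw hfi hfpos hsol
  -- `X = ‖w‖² = ∫ f w` is positive because `f` and `w` are.
  set X : ℝ := ∫ x in Ω, ‖W x‖ ^ 2 with hXdef
  have hXeq : X = ∫ x in Ω, f x * w x := by
    rw [← hsol w W hw]
    simp only [real_inner_self_eq_norm_sq, hXdef]
  have hX : 0 < X := by
    rw [hXeq]
    have h0 : ∀ᵐ x ∂(volume.restrict Ω), 0 < f x * w x := by
      filter_upwards [hfpos, hwpos] with x h1 h2
      exact mul_pos h1 h2
    refine lt_of_le_of_ne (integral_nonneg_of_ae (h0.mono fun x hx => hx.le)) fun h => ?_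
    have hz := (integral_eq_zero_iff_of_nonneg_ae (h0.mono fun x hx => hx.le)
      (hprod w W hw)).1 h.symm
    have hfalse : ∀ᵐ x ∂(volume.restrict Ω), False := by
      filter_upwards [h0, hz] with x h1 h2
      exact h1.ne' h2
    rw [ae_iff] at hfalse
    simp only [not_false_eq_true, Set.ofPred_true, Measure.restrict_apply_univ] at hfalse
    exact (hΩo.measure_pos volume hΩne).ne' hfalse
  obtain ⟨s, hs, hsμ⟩ := exists_pos_cubic_eq ha hb hX hμ
  have hu := hw.const_smul (-s)
  have hnorm : h10Norm Ω (fun x => -s * w x) ^ 2 = s ^ 2 * X := by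
    rw [hu.h10Norm_sq hΩo]
    simp only [norm_smul, mul_pow, norm_neg, Real.norm_eq_abs, sq_abs]
    exact integral_const_mul _ _
  have hgt : a < b * (s ^ 2 * X) := by
    have : 0 < s * (b * (s ^ 2 * X) - a) := hsμ ▸ hμ
    linarith [pos_of_mul_pos_right this hs.le]
  have hfu : ∫ x in Ω, f x * (-s * w x) = -s * X := by
    rw [hXeq, ← integral_const_mul]
    refine integral_congr_ae (.of_forall fun x => ?_)
    change f x * (-s * w x) = -s * (f x * w x)
    ring
  refine ⟨fun x => -s * w x, ⟨hu.memH10 hΩo, fun v hv => ?_⟩, ?_, ?_, ?_⟩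
  · have hv' := hv.isH10Pair hΩo
    refine ⟨hprod v _ hv', ?_⟩
    have hinner : h10Inner Ω (fun x => -s * w x) v = -s * ∫ x in Ω, f x * v x := by
      rw [← hsol v _ hv', ← integral_const_mul]
      refine integral_congr_ae ?_
      filter_upwards [hu.weakGradient_ae_eq hΩo] with x hx
      rw [hx, real_inner_smul_left]
    rw [hnorm, hinner, ← hsμ]
    ring
  · filter_upwards [hwpos] with x hx
    nlinarith
  · have h4 : h10Norm Ω (fun x => -s * w x) ^ 4 = (s ^ 2 * X) ^ 2 := by
      rw [← hnorm]
      ring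
    rw [energy, h4, hnorm, hfu, div_lt_iff₀ (by positivity), ← hsμ]
    -- `4 b I(u) - a² = (3 b ‖u‖² + a) (b ‖u‖² - a)`.
    have h5 : 0 < (3 * (b * (s ^ 2 * X)) + a) * (b * (s ^ 2 * X) - a) :=
      mul_pos (by positivity) (by linarith)
    linarith [h5]
  · rw [hnorm, div_lt_iff₀ hb]
    linarith
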